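/- For an entire function $f:\mathbb{C}^2\to\mathbb{C}$ and $r>0$ put $$M(f,r)=\sup\{|f(\zeta\theta)| : \zeta\in\mathbb{C},\ |\zeta|=r,\ \theta\in\mathbb{R}^2,\ |\theta|=1\},$$ and let the order of $f$ be $$\rho(f)=\limsup_{r\to\infty}\frac{\log\log M(f,r)}{\log r}$$ if $f$ is non-constant, and $\rho(f)=0$ if $f$ is constant. (The same order is obtained from the supremum of $|f|$ over the sphere $|z|=r$ in $\mathbb{C}^2$.) An entire function is called harmonic if its restriction to $\mathbb{R}^2$ satisfies $\partial^2 h/\partial x_1^2+\partial^2 h/\partial x_2^2=0$. **Theorem.** Let $f:\mathbb{C}^2\to\mathbb{C}$ be an entire function of order $\rho(f)<\tfrac12$, and let $a\neq 0$ be a real number. Then there exists an entire harmonic function $h:\mathbb{C}^2\to\mathbb{C}$ of order $\rho(h)\le\rho(f)$ such that $h=f$ on the parabola $\{(x_1,x_2)\in\mathbb{R}^2 : a x_1=x_2^2\}$. -/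

import Mathlib

open scoped Topology

noncomputable section

/-- The inclusion of `ℝᵈ` into `ℂᵈ`. -/
def complexify {d : ℕ} (x : EuclideanSpace ℝ (Fin d)) : EuclideanSpace ℂ (Fin d) :=
  WithLp.toLp 2 (fun i => (x i : ℂ))

/-- An entire function on `ℂᵈ`. -/
def IsEntire {d : ℕ} (f : EuclideanSpace ℂ (Fin d) → ℂ) : Prop :=
  Differentiable ℂ f

/-- `M(f, r) = sup { |f(ζ θ)| : ζ ∈ ℂ, |ζ| = r, θ ∈ 𝕊ᵈ⁻¹ }`, where `𝕊ᵈ⁻¹` is the unit sphere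
of `ℝᵈ`. -/
def maxModulus {d : ℕ} (f : EuclideanSpace ℂ (Fin d) → ℂ) (r : ℝ) : ℝ :=
  sSup {y : ℝ | ∃ (ζ : ℂ) (θ : EuclideanSpace ℝ (Fin d)),
    ‖ζ‖ = r ∧ ‖θ‖ = 1 ∧ y = ‖f (ζ • complexify θ)‖}

/-- The order `ρ(f) = limsup_{r → ∞} log log M(f, r) / log r`, an extended real number.
For a nonconstant entire `f` one has `M(f, r) → ∞`, so that both logarithms are eventually
genuine; for a constant `f` the numerator does not depend on `r`, and the order is `0`. -/
def order {d : ℕ} (f : EuclideanSpace ℂ (Fin d) → ℂ) : EReal :=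
  Filter.limsup
    (fun r : ℝ => ((Real.log (Real.log (maxModulus f r)) / Real.log r : ℝ) : EReal))
    Filter.atTop

/-- An entire harmonic function: an entire function whose restriction to `ℝᵈ` is harmonic. -/
def IsEntireHarmonic {d : ℕ} (h : EuclideanSpace ℂ (Fin d) → ℂ) : Prop :=
  IsEntire h ∧
    InnerProductSpace.HarmonicOnNhd (fun x : EuclideanSpace ℝ (Fin d) => h (complexify x))
      Set.univ

/-- The parabola `{(x₁, x₂) ∈ ℝ² : a x₁ = x₂²}`. -/
def parabola (a : ℝ) : Set (EuclideanSpace ℝ (Fin 2)) :=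
  {x | a * x 0 = x 1 ^ 2}

end

/-! Parametrize the parabola by `t ↦ (a t², a t)` and put `F(t) = f(a t², a t)`. Any `A(z₁ + i z₂) +
B(z₁ - i z₂)` with `A`, `B` entire is harmonic, and on the parabola `(z₁ ± i z₂)/a - 1/4 = (t ±
i/2)²`. It therefore suffices to write `F(t) = φ(t + i/2) + ψ(t - i/2)` with `φ`, `ψ` even, hence
entire functions of the square.

Order below `1/2` for `f` bounds `F` by `exp (L (|t| + R)^(2s))` with `2s < 1`. Such a bound hardly
changes over bounded steps, so by Cauchy's estimate averaging over `t ± i/2` is close to the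
identity and is inverted by a Neumann series (`exists_shift_add_shift`, `exists_shift_sub_shift`).
The growth worsens only by a factor linear in `|t|`, and passing from `t` to `t²` halves the
exponent `2s` again. -/

/-! ### Slow weights and Cauchy estimates -/

/-- A non-negative function on the half-line, monotone and at most doubling over steps of
length `9`: the growth bounds for which the shift equations below are solved by iteration. -/
structure IsSlowWeight (W : ℝ → ℝ) : Prop where
  nonneg : ∀ x, 0 ≤ x → 0 ≤ W x
  mono : ∀ x y, 0 ≤ x → x ≤ y → W x ≤ W y
  doubling : ∀ x, 0 ≤ x → W (x + 9) ≤ 2 * W x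

theorem IsSlowWeight.const_mul {W : ℝ → ℝ} (hW : IsSlowWeight W) {c : ℝ} (hc : 0 ≤ c) :
    IsSlowWeight (fun x => c * W x) where
  nonneg x hx := mul_nonneg hc (hW.nonneg x hx)
  mono x y hx hxy := mul_le_mul_of_nonneg_left (hW.mono x y hx hxy) hc
  doubling x hx := by
    have := mul_le_mul_of_nonneg_left (hW.doubling x hx) hc
    linarith

/-- Cauchy's estimate on the circle of radius `8` about `z`: it lies in `|w| ≤ |t| + 9`, where
doubling gives `2 W`, and `2 / 8 = 1 / 4`. -/
theorem IsSlowWeight.norm_deriv_le {W : ℝ → ℝ} (hW : IsSlowWeight W) {F : ℂ → ℂ}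
    (hF : Differentiable ℂ F) (hb : ∀ t, ‖F t‖ ≤ W ‖t‖) {t z : ℂ} (hz : ‖z - t‖ ≤ 1) :
    ‖deriv F z‖ ≤ W ‖t‖ / 4 := by
  have h := Complex.norm_deriv_le_of_forall_mem_sphere_norm_le (c := z) (R := 8)
    (C := 2 * W ‖t‖) (f := F) (by norm_num) hF.diffContOnCl ?_
  · linarith
  · intro w hw
    have hw' : ‖w - z‖ = 8 := by simpa [dist_eq_norm] using hw
    refine (hb w).trans ((hW.mono _ _ (norm_nonneg _) ?_).trans (hW.doubling _ (norm_nonneg t)))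
    calc ‖w‖ = ‖t + (z - t) + (w - z)‖ := by congr 1; ring
      _ ≤ ‖t‖ + ‖z - t‖ + ‖w - z‖ := norm_add₃_le
      _ ≤ ‖t‖ + 9 := by linarith

theorem IsSlowWeight.norm_sub_le {W : ℝ → ℝ} (hW : IsSlowWeight W) {F : ℂ → ℂ}
    (hF : Differentiable ℂ F) (hb : ∀ t, ‖F t‖ ≤ W ‖t‖) (t : ℂ) {s : ℂ} (hs : ‖s‖ ≤ 1) :
    ‖F (t + s) - F t‖ ≤ W ‖t‖ / 4 := by
  have h := (convex_closedBall t (1 : ℝ)).norm_image_sub_le_of_norm_deriv_le (𝕜 := ℂ) (f := F)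
    (x := t) (y := t + s) (C := W ‖t‖ / 4) (fun x _ => hF x)
    (fun x hx => hW.norm_deriv_le hF hb (by simpa [dist_eq_norm] using hx))
    (by simp) (by simpa [dist_eq_norm] using hs)
  have h0 := hW.nonneg _ (norm_nonneg t)
  have h1 : W ‖t‖ / 4 * ‖t + s - t‖ ≤ W ‖t‖ / 4 * 1 := by
    apply mul_le_mul_of_nonneg_left _ (by linarith)
    simpa using hs
  linarith

/-! ### Shift equations solved by Neumann series -/

theorem Complex.norm_I_div_two : ‖Complex.I / 2‖ = 1 / 2 := by simp

/-- The defect of the symmetric average over the shifts by `± i / 2`. -/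
noncomputable def averageDefect (F : ℂ → ℂ) (t : ℂ) : ℂ :=
  F t - (F (t + Complex.I / 2) + F (t - Complex.I / 2)) / 2

theorem differentiable_averageDefect {F : ℂ → ℂ} (hF : Differentiable ℂ F) :
    Differentiable ℂ (averageDefect F) := by
  unfold averageDefect
  fun_prop

theorem IsSlowWeight.norm_averageDefect_le {W : ℝ → ℝ} (hW : IsSlowWeight W) {F : ℂ → ℂ}
    (hF : Differentiable ℂ F) (hb : ∀ t, ‖F t‖ ≤ W ‖t‖) (t : ℂ) :
    ‖averageDefect F t‖ ≤ 1 / 2 * W ‖t‖ := by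
  have h1 := hW.norm_sub_le hF hb t (s := Complex.I / 2) (by rw [Complex.norm_I_div_two]; norm_num)
  have h2 := hW.norm_sub_le hF hb t (s := -(Complex.I / 2))
    (by rw [norm_neg, Complex.norm_I_div_two]; norm_num)
  have h0 := hW.nonneg _ (norm_nonneg t)
  have : averageDefect F t = -(1 / 2 : ℂ) * ((F (t + Complex.I / 2) - F t)
      + (F (t + -(Complex.I / 2)) - F t)) := by
    unfold averageDefect
    rw [← sub_eq_add_neg]
    ring
  rw [this, norm_mul]
  have h3 := norm_add_le (F (t + Complex.I / 2) - F t) (F (t + -(Complex.I / 2)) - F t)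
  have h4 : ‖-(1 / 2 : ℂ)‖ = 1 / 2 := by simp
  rw [h4]
  linarith

theorem summable_of_norm_le_geometric {V : ℝ} {g : ℕ → ℂ} (hb : ∀ n, ‖g n‖ ≤ (1 / 2) ^ n * V) :
    Summable g :=
  Summable.of_norm_bounded (summable_geometric_two.mul_right V) hb

theorem norm_tsum_le_of_norm_le_geometric {V : ℝ} {g : ℕ → ℂ}
    (hb : ∀ n, ‖g n‖ ≤ (1 / 2) ^ n * V) : ‖∑' n, g n‖ ≤ 2 * V :=
  tsum_of_norm_bounded (hasSum_geometric_two.mul_right V) hb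

theorem differentiable_tsum_of_norm_le_geometric {V : ℝ → ℝ}
    (hV : ∀ x y, 0 ≤ x → x ≤ y → V x ≤ V y) {G : ℕ → ℂ → ℂ} (hG : ∀ n, Differentiable ℂ (G n))
    (hb : ∀ n t, ‖G n t‖ ≤ (1 / 2) ^ n * V ‖t‖) : Differentiable ℂ (fun t => ∑' n, G n t) := by
  intro z
  have h := Complex.differentiableOn_tsum_of_summable_norm (F := G)
    (U := Metric.ball 0 (‖z‖ + 1)) (summable_geometric_two.mul_right (V (‖z‖ + 1)))
    (fun n => (hG n).differentiableOn) Metric.isOpen_ball ?_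
  · exact h.differentiableAt (Metric.isOpen_ball.mem_nhds (by simp))
  · intro n w hw
    refine (hb n w).trans (mul_le_mul_of_nonneg_left (hV _ _ (norm_nonneg w) ?_) (by positivity))
    simpa using (Metric.mem_ball.1 hw).le

/-- With `M` the average and `E = 1 - M` the defect, `M (∑ Eⁿ F) = F`, and the sum of the shifts is
`2 M`. One `S` serves every weight `W`, so the growth exponent may later tend to the order. -/
theorem exists_shift_add_shift {F : ℂ → ℂ} (hF : Differentiable ℂ F)
    (hW : ∃ W, IsSlowWeight W ∧ ∀ t, ‖F t‖ ≤ W ‖t‖) :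
    ∃ S : ℂ → ℂ, Differentiable ℂ S ∧
      (∀ t, S (t + Complex.I / 2) + S (t - Complex.I / 2) = F t) ∧
      ∀ W, IsSlowWeight W → (∀ t, ‖F t‖ ≤ W ‖t‖) → ∀ t, ‖S t‖ ≤ W ‖t‖ := by
  have hd : ∀ n, Differentiable ℂ (averageDefect^[n] F) := by
    intro n
    induction n with
    | zero => simpa using hF
    | succ n ih => rw [Function.iterate_succ_apply']; exact differentiable_averageDefect ih
  have hb : ∀ W, IsSlowWeight W → (∀ t, ‖F t‖ ≤ W ‖t‖) → ∀ n t,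
      ‖averageDefect^[n] F t‖ ≤ (1 / 2) ^ n * W ‖t‖ := by
    intro W hW hFW n
    induction n with
    | zero => simpa using hFW
    | succ n ih =>
      intro t
      rw [Function.iterate_succ_apply', pow_succ, mul_comm ((1 / 2 : ℝ) ^ n), mul_assoc]
      exact (hW.const_mul (by positivity)).norm_averageDefect_le (hd n) ih t
  obtain ⟨W, hW, hFW⟩ := hW
  have hs : ∀ t, Summable fun n => averageDefect^[n] F t := fun t =>
    summable_of_norm_le_geometric (fun n => hb W hW hFW n t)
  refine ⟨fun t => (1 / 2) * ∑' n, averageDefect^[n] F t, ?_, ?_, ?_⟩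
  · exact (differentiable_tsum_of_norm_le_geometric hW.mono hd (hb W hW hFW)).const_mul _
  · intro t
    have h := (hs t).tsum_eq_zero_add
    have h' : ∑' n, averageDefect^[n + 1] F t = ∑' n, averageDefect^[n] F t
        - (∑' n, averageDefect^[n] F (t + Complex.I / 2)
          + ∑' n, averageDefect^[n] F (t - Complex.I / 2)) / 2 := by
      rw [← (hs _).tsum_add (hs _), ← tsum_div_const,
        ← (hs t).tsum_sub (((hs _).add (hs _)).div_const _)]
      refine tsum_congr fun n => ?_
      rw [Function.iterate_succ_apply']
      rfl
    rw [h'] at h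
    simp only [Function.iterate_zero, id] at h
    linear_combination h
  · intro W hW hFW t
    have := norm_tsum_le_of_norm_le_geometric (fun n => hb W hW hFW n t)
    rw [norm_mul]
    have h4 : ‖(1 / 2 : ℂ)‖ = 1 / 2 := by simp
    rw [h4]
    linarith

/-- The derivative in `s` of `K (t + s) - s F t` is the small increment `F (t + s) - F t`; compare
`s = ± i/2`. -/
theorem IsSlowWeight.norm_primitive_shift_le {W : ℝ → ℝ} (hW : IsSlowWeight W) {F K : ℂ → ℂ}
    (hF : Differentiable ℂ F) (hb : ∀ t, ‖F t‖ ≤ W ‖t‖) (hK : ∀ z, HasDerivAt K (F z) z) (t : ℂ) :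
    ‖F t + Complex.I * (K (t + Complex.I / 2) - K (t - Complex.I / 2))‖ ≤ 1 / 2 * W ‖t‖ := by
  have hder : ∀ s : ℂ, HasDerivAt (fun s => K (t + s) - s * F t) (F (t + s) - F t) s := by
    intro s
    have h1 := (hK (t + s)).comp_const_add t s
    have h2 := h1.sub ((hasDerivAt_id s).mul_const (F t))
    rw [one_mul] at h2
    exact h2
  have h := (convex_closedBall (0 : ℂ) (1 : ℝ)).norm_image_sub_le_of_norm_hasDerivWithin_le
    (𝕜 := ℂ) (x := -(Complex.I / 2)) (y := Complex.I / 2) (C := W ‖t‖ / 4)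
    (fun s _ => (hder s).hasDerivWithinAt)
    (fun s hs => hW.norm_sub_le hF hb t (by simpa using hs))
    (by simp; norm_num) (by simp; norm_num)
  have h0 := hW.nonneg _ (norm_nonneg t)
  have e1 : F t + Complex.I * (K (t + Complex.I / 2) - K (t - Complex.I / 2)) =
      Complex.I * (K (t + Complex.I / 2) - Complex.I / 2 * F t
        - (K (t + -(Complex.I / 2)) - -(Complex.I / 2) * F t)) := by
    rw [← sub_eq_add_neg]
    linear_combination F t * Complex.I_sq
  have e2 : ‖Complex.I / 2 - -(Complex.I / 2)‖ = 1 := by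
    rw [show Complex.I / 2 - -(Complex.I / 2) = Complex.I by ring, Complex.norm_I]
  rw [e1, norm_mul, Complex.norm_I, one_mul]
  rw [e2] at h
  linarith

/-- The difference of shifts is not near the identity, but composed with a primitive it becomes, up
to the factor `i`, the mean over the segment from `t - i/2` to `t + i/2`, which is. The primitive
costs the factor `‖t‖`. -/
theorem exists_shift_sub_shift {F : ℂ → ℂ} (hF : Differentiable ℂ F)
    (hW : ∃ W, IsSlowWeight W ∧ ∀ t, ‖F t‖ ≤ W ‖t‖) :
    ∃ D : ℂ → ℂ, Differentiable ℂ D ∧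
      (∀ t, D (t + Complex.I / 2) - D (t - Complex.I / 2) = F t) ∧
      ∀ W, IsSlowWeight W → (∀ t, ‖F t‖ ≤ W ‖t‖) → ∀ t, ‖D t‖ ≤ 2 * (‖t‖ * W ‖t‖) := by
  -- Quantifying over all `G` makes `P` a total operator that can be iterated; only its values on
  -- entire functions matter.
  have hprim : ∀ G : ℂ → ℂ, ∃ K : ℂ → ℂ, Differentiable ℂ G →
      K 0 = 0 ∧ ∀ z, HasDerivAt K (G z) z := by
    intro G
    by_cases hG : Differentiable ℂ G
    · obtain ⟨K, hK0, hK⟩ := (hG.isExactOn_univ).with_val_at 0 0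
      exact ⟨K, fun _ => ⟨hK0, fun z => hK z (Set.mem_univ z)⟩⟩
    · exact ⟨0, fun h => absurd h hG⟩
  choose P hP using hprim
  set T : (ℂ → ℂ) → ℂ → ℂ := fun G t =>
    G t + Complex.I * (P G (t + Complex.I / 2) - P G (t - Complex.I / 2)) with hT
  have hPd : ∀ G, Differentiable ℂ G → Differentiable ℂ (P G) := fun G hG z =>
    ((hP G hG).2 z).differentiableAt
  have hd : ∀ n, Differentiable ℂ (T^[n] F) := by
    intro n
    induction n with
    | zero => simpa using hF
    | succ n ih =>
      rw [Function.iterate_succ_apply', hT]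
      have := hPd _ ih
      fun_prop
  have hb : ∀ W, IsSlowWeight W → (∀ t, ‖F t‖ ≤ W ‖t‖) → ∀ n t,
      ‖T^[n] F t‖ ≤ (1 / 2) ^ n * W ‖t‖ := by
    intro W hW hFW n
    induction n with
    | zero => simpa using hFW
    | succ n ih =>
      intro t
      rw [Function.iterate_succ_apply', pow_succ, mul_comm ((1 / 2 : ℝ) ^ n), mul_assoc]
      exact (hW.const_mul (by positivity)).norm_primitive_shift_le (hd n) ih (hP _ (hd n)).2 t
  have hbP : ∀ W, IsSlowWeight W → (∀ t, ‖F t‖ ≤ W ‖t‖) → ∀ n t,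
      ‖P (T^[n] F) t‖ ≤ (1 / 2) ^ n * (‖t‖ * W ‖t‖) := by
    intro W hW hFW n t
    have h := (convex_closedBall (0 : ℂ) ‖t‖).norm_image_sub_le_of_norm_hasDerivWithin_le
      (𝕜 := ℂ) (x := 0) (y := t) (C := (1 / 2) ^ n * W ‖t‖)
      (fun s _ => ((hP _ (hd n)).2 s).hasDerivWithinAt)
      (fun s hs => (hb W hW hFW n s).trans
        (mul_le_mul_of_nonneg_left (hW.mono _ _ (norm_nonneg s) (by simpa using hs))
          (by positivity)))
      (by simp) (by simp)
    rw [(hP _ (hd n)).1, sub_zero, sub_zero] at h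
    linarith
  obtain ⟨W, hW, hFW⟩ := hW
  have hs : ∀ t, Summable fun n => T^[n] F t := fun t =>
    summable_of_norm_le_geometric (fun n => hb W hW hFW n t)
  have hsP : ∀ t, Summable fun n => P (T^[n] F) t := fun t =>
    summable_of_norm_le_geometric (fun n => hbP W hW hFW n t)
  refine ⟨fun t => -Complex.I * ∑' n, P (T^[n] F) t, ?_, ?_, ?_⟩
  · refine (differentiable_tsum_of_norm_le_geometric (V := fun x => x * W x) ?_
      (fun n => hPd _ (hd n)) (hbP W hW hFW)).const_mul _
    intro x y hx hxy
    exact mul_le_mul hxy (hW.mono x y hx hxy) (hW.nonneg x hx) (hx.trans hxy)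
  · intro t
    have h := (hs t).tsum_eq_zero_add
    have h' : ∑' n, T^[n + 1] F t = ∑' n, T^[n] F t
        + Complex.I * (∑' n, P (T^[n] F) (t + Complex.I / 2)
          - ∑' n, P (T^[n] F) (t - Complex.I / 2)) := by
      rw [← (hsP _).tsum_sub (hsP _), ← tsum_mul_left,
        ← (hs t).tsum_add (((hsP _).sub (hsP _)).mul_left _)]
      refine tsum_congr fun n => ?_
      rw [Function.iterate_succ_apply']
    rw [h'] at h
    simp only [Function.iterate_zero, id] at h
    linear_combination h
  · intro W hW hFW t
    have := norm_tsum_le_of_norm_le_geometric (fun n => hbP W hW hFW n t)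
    rw [norm_mul, norm_neg, Complex.norm_I, one_mul]
    exact this

theorem norm_half_add_le {a b : ℂ} {c : ℝ} (ha : ‖a‖ ≤ c) (hb : ‖b‖ ≤ c) :
    ‖(a + b) / 2‖ ≤ c := by
  rw [norm_div, Complex.norm_two]
  linarith [norm_add_le a b]

/-- Every entire function of slow growth is a sum of shifts by `± i / 2` of even entire functions
of comparable growth. -/
theorem exists_even_shift_add_even_shift {F : ℂ → ℂ} (hF : Differentiable ℂ F)
    (hW : ∃ W, IsSlowWeight W ∧ ∀ t, ‖F t‖ ≤ W ‖t‖) :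
    ∃ φ ψ : ℂ → ℂ, Differentiable ℂ φ ∧ Differentiable ℂ ψ ∧ (∀ t, φ (-t) = φ t) ∧
      (∀ t, ψ (-t) = ψ t) ∧ (∀ t, φ (t + Complex.I / 2) + ψ (t - Complex.I / 2) = F t) ∧
      ∀ W, IsSlowWeight W → (∀ t, ‖F t‖ ≤ W ‖t‖) → ∀ t,
        ‖φ t‖ ≤ (1 + 2 * ‖t‖) * W ‖t‖ ∧ ‖ψ t‖ ≤ (1 + 2 * ‖t‖) * W ‖t‖ := by
  have hE : ∀ W : ℝ → ℝ, (∀ t, ‖F t‖ ≤ W ‖t‖) → ∀ t, ‖(F t + F (-t)) / 2‖ ≤ W ‖t‖ :=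
    fun W h t => norm_half_add_le (h t) (by simpa using h (-t))
  have hO : ∀ W : ℝ → ℝ, (∀ t, ‖F t‖ ≤ W ‖t‖) → ∀ t, ‖(F t + -F (-t)) / 2‖ ≤ W ‖t‖ :=
    fun W h t => norm_half_add_le (h t) (by simpa using h (-t))
  obtain ⟨W, hW, hFW⟩ := hW
  obtain ⟨S, hSd, hS, hSb⟩ := exists_shift_add_shift (F := fun t => (F t + F (-t)) / 2)
    (by fun_prop) ⟨W, hW, hE W hFW⟩
  obtain ⟨D, hDd, hD, hDb⟩ := exists_shift_sub_shift (F := fun t => (F t + -F (-t)) / 2)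
    (by fun_prop) ⟨W, hW, hO W hFW⟩
  -- Symmetrizing keeps both equations: reflection swaps the two shifts, which suits the even part
  -- for `S` and the odd part for `D`.
  refine ⟨fun t => (S t + S (-t)) / 2 + (D t + D (-t)) / 2,
    fun t => (S t + S (-t)) / 2 - (D t + D (-t)) / 2, by fun_prop, by fun_prop, ?_, ?_, ?_, ?_⟩
  · intro t
    simp only [neg_neg]
    ring
  · intro t
    simp only [neg_neg]
    ring
  · intro t
    have h1 := hS t
    have h2 := hS (-t)
    have h3 := hD t
    have h4 := hD (-t)
    simp only [neg_neg] at h2 h4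
    dsimp only
    rw [show -(t + Complex.I / 2) = -t - Complex.I / 2 by ring,
      show -(t - Complex.I / 2) = -t + Complex.I / 2 by ring]
    linear_combination h1 / 2 + h2 / 2 + h3 / 2 - h4 / 2
  · intro W hW hFW t
    have h1 := norm_half_add_le (hSb W hW (hE W hFW) t)
      (by simpa using hSb W hW (hE W hFW) (-t))
    have h2 := norm_half_add_le (hDb W hW (hO W hFW) t)
      (by simpa using hDb W hW (hO W hFW) (-t))
    constructor
    · refine (norm_add_le _ _).trans ?_
      linarith
    · refine (norm_sub_le _ _).trans ?_
      linarith

/-! ### Functions of the square and harmonicity -/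

/-- An even entire function is an entire function of the square. -/
theorem exists_differentiable_comp_sq {φ : ℂ → ℂ} (hφ : Differentiable ℂ φ)
    (heven : ∀ t, φ (-t) = φ t) :
    ∃ α : ℂ → ℂ, Differentiable ℂ α ∧ ∀ s, α (s ^ 2) = φ s := by
  set c : ℕ → ℂ := fun n => (n.factorial : ℂ)⁻¹ * iteratedDeriv n φ 0 with hc
  have hsum : ∀ s, HasSum (fun n => c n * s ^ n) (φ s) := by
    intro s
    have := Complex.hasSum_taylorSeries_of_entire hφ 0 s
    simp only [sub_zero, smul_eq_mul] at this
    refine this.congr_fun ?_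
    intro n
    simp only [hc]
    ring
  have heven' : ∀ s, HasSum (fun n => c (2 * n) * (s ^ 2) ^ n) (φ s) := by
    intro s
    have h := (hsum s).add (hsum (-s))
    rw [heven s] at h
    have h2 := h.div_const 2
    rw [show (φ s + φ s) / 2 = φ s by ring] at h2
    have hinj : Function.Injective fun n : ℕ => 2 * n := fun a b h => by simpa using h
    have h3 := (hinj.hasSum_iff (a := φ s)
      (f := fun n => (c n * s ^ n + c n * (-s) ^ n) / 2) ?_).2 h2
    · refine h3.congr_fun ?_
      intro n
      simp only [Function.comp_apply, pow_mul, neg_sq]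
      ring
    · intro n hn
      have : Odd n := by
        rw [← Nat.not_even_iff_odd]
        rintro ⟨k, hk⟩
        exact hn ⟨k, by simp only; omega⟩
      rw [this.neg_pow]
      ring
  refine ⟨fun w => ∑' n, c (2 * n) * w ^ n, ?_, fun s => (heven' s).tsum_eq⟩
  intro z
  set R : ℝ := ‖z‖ + 1 with hR
  have hRs : Summable fun n => ‖c (2 * n)‖ * R ^ n := by
    -- Absolute convergence at radius `R` in `w` is convergence of the series of `φ` at `√R`.
    have h := (heven' ((Real.sqrt R : ℝ) : ℂ)).summable.norm
    refine h.congr fun n => ?_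
    rw [← Complex.ofReal_pow, Real.sq_sqrt (by positivity), norm_mul, norm_pow,
      Complex.norm_real, Real.norm_of_nonneg (by positivity)]
  have h := Complex.differentiableOn_tsum_of_summable_norm
    (F := fun (n : ℕ) (w : ℂ) => c (2 * n) * w ^ n)
    (U := Metric.ball 0 R) hRs (fun n => by fun_prop) Metric.isOpen_ball ?_
  · exact h.differentiableAt (Metric.isOpen_ball.mem_nhds (by simp [hR]))
  · intro n w hw
    rw [norm_mul, norm_pow]
    have : ‖w‖ ≤ R := by simpa using (Metric.mem_ball.1 hw).le
    gcongr

/-- The composition of an entire function with `x ↦ x₁ + c x₂`, `c² = -1`, is harmonic. -/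
theorem harmonicAt_comp_isotropic {A : ℂ → ℂ} (hA : Differentiable ℂ A) {c : ℂ}
    (hc : c ^ 2 = -1) (x : EuclideanSpace ℝ (Fin 2)) :
    InnerProductSpace.HarmonicAt
      (fun x : EuclideanSpace ℝ (Fin 2) => A ((x 0 : ℂ) + c * (x 1 : ℂ))) x := by
  set ℓ : EuclideanSpace ℝ (Fin 2) →L[ℝ] ℂ :=
    Complex.ofRealCLM.comp (EuclideanSpace.proj 0)
      + c • Complex.ofRealCLM.comp (EuclideanSpace.proj 1) with hℓ
  have hfun : (fun x : EuclideanSpace ℝ (Fin 2) => A ((x 0 : ℂ) + c * (x 1 : ℂ))) = A ∘ ℓ := by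
    ext x
    simp [hℓ]
  rw [hfun]
  have hAC : ContDiff ℂ 2 A := hA.contDiff
  have hAR : ContDiff ℝ 2 A := hAC.restrict_scalars ℝ
  refine ⟨(hAR.comp ℓ.contDiff).contDiffAt, Filter.Eventually.of_forall fun y => ?_⟩
  rw [InnerProductSpace.laplacian_eq_iteratedFDeriv_orthonormalBasis _
    (EuclideanSpace.basisFun (Fin 2) ℝ)]
  have hr := (hAC.contDiffAt (x := ℓ y)).restrictScalars_iteratedFDeriv (𝕜 := ℝ)
  have hr' : ∀ m, iteratedFDeriv ℝ 2 A (ℓ y) m = iteratedFDeriv ℂ 2 A (ℓ y) m := by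
    intro m
    rw [← hr, Function.comp_apply, ContinuousMultilinearMap.coe_restrictScalars]
  -- The second derivative along `v` is `ℓ(v)² A''`, so the Laplacian carries the factor `1 + c² =
  -- 0`.
  have h2 : ∀ v, iteratedFDeriv ℝ 2 (A ∘ ℓ) y ![v, v]
      = ℓ v ^ 2 * iteratedFDeriv ℂ 2 A (ℓ y) ![1, 1] := by
    intro v
    rw [ℓ.iteratedFDeriv_comp_right hAR y le_rfl]
    have hm := (iteratedFDeriv ℂ 2 A (ℓ y)).map_smul_univ (fun _ => ℓ v) ![1, 1]
    simp only [Finset.prod_const, Finset.card_univ, Fintype.card_fin, smul_eq_mul] at hm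
    rw [← hm, ContinuousMultilinearMap.compContinuousLinearMap_apply, hr']
    congr 1
    ext i
    fin_cases i <;> simp
  simp only [h2, Fin.sum_univ_two, ← add_mul, Pi.zero_apply]
  have : ℓ ((EuclideanSpace.basisFun (Fin 2) ℝ) 0) ^ 2
      + ℓ ((EuclideanSpace.basisFun (Fin 2) ℝ) 1) ^ 2 = 0 := by
    simp [hℓ, hc]
  rw [this, zero_mul]

/-! ### Isotropic coordinates and the maximum modulus -/

/-- The point of `ℂ²` with isotropic coordinates `z₁ + i z₂ = u` and `z₁ - i z₂ = v`. -/
noncomputable def isotropicPoint (u v : ℂ) : EuclideanSpace ℂ (Fin 2) :=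
  WithLp.toLp 2 ![(u + v) / 2, (u - v) / (2 * Complex.I)]

theorem isotropicPoint_eq (z : EuclideanSpace ℂ (Fin 2)) :
    isotropicPoint (z 0 + Complex.I * z 1) (z 0 - Complex.I * z 1) = z := by
  ext i
  fin_cases i
  · simp [isotropicPoint]
  · simp only [isotropicPoint]
    simp
    field_simp
    ring

theorem differentiable_isotropicPoint_left (v : ℂ) :
    Differentiable ℂ fun u => isotropicPoint u v := by
  rw [differentiable_euclidean]
  intro i
  fin_cases i <;> simp [isotropicPoint]

theorem differentiable_isotropicPoint_right (u : ℂ) :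
    Differentiable ℂ fun v => isotropicPoint u v := by
  rw [differentiable_euclidean]
  intro i
  fin_cases i <;> simp [isotropicPoint] <;> fun_prop

/-- Take `ζ² = u v`; then `w = u / ζ` is unimodular, `v = ζ w̄`, and `θ = (Re w, Im w)`. Thus `M(f,
r)` is a supremum over the whole torus `|u| = |v| = r`. -/
theorem exists_smul_complexify_eq {r : ℝ} (hr : 0 < r) {u v : ℂ} (hu : ‖u‖ = r) (hv : ‖v‖ = r) :
    ∃ (ζ : ℂ) (θ : EuclideanSpace ℝ (Fin 2)), ‖ζ‖ = r ∧ ‖θ‖ = 1 ∧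
      ζ • complexify θ = isotropicPoint u v := by
  obtain ⟨ζ, hζ⟩ := IsAlgClosed.exists_pow_nat_eq (u * v) two_pos
  have hζr : ‖ζ‖ = r := by
    have := congrArg norm hζ
    rw [norm_pow, norm_mul, hu, hv, ← sq] at this
    exact (pow_left_inj₀ (norm_nonneg _) hr.le two_ne_zero).1 this
  have hζ0 : ζ ≠ 0 := norm_ne_zero_iff.1 (by rw [hζr]; exact hr.ne')
  have hu0 : u ≠ 0 := norm_ne_zero_iff.1 (by rw [hu]; exact hr.ne')
  set w : ℂ := u / ζ with hw
  have hw1 : ‖w‖ = 1 := by rw [hw, norm_div, hu, hζr, div_self hr.ne']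
  have hw0 : w ≠ 0 := div_ne_zero hu0 hζ0
  have huw : u = ζ * w := by rw [hw]; field_simp
  have hvw : v = ζ * (starRingEnd ℂ) w := by
    rw [← Complex.inv_eq_conj hw1, hw]
    field_simp
    linear_combination -hζ
  refine ⟨ζ, WithLp.toLp 2 ![w.re, w.im], hζr, ?_, ?_⟩
  · rw [EuclideanSpace.norm_eq, Fin.sum_univ_two]
    simp only [Matrix.cons_val_zero, Matrix.cons_val_one, Real.norm_eq_abs, sq_abs]
    rw [Real.sqrt_eq_one, ← one_pow 2, ← hw1, Complex.sq_norm, Complex.normSq_apply]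
    ring
  · have e1 : (w + (starRingEnd ℂ) w) = 2 * w.re := by rw [Complex.add_conj]; push_cast; ring
    have e2 : (w - (starRingEnd ℂ) w) = 2 * w.im * Complex.I := by
      rw [Complex.sub_conj]; push_cast; ring
    ext i
    fin_cases i
    · simp only [isotropicPoint, complexify]
      simp
      rw [huw, hvw]
      linear_combination -ζ / 2 * e1
    · simp only [isotropicPoint, complexify]
      simp
      rw [huw, hvw, eq_div_iff (by simp)]
      linear_combination -ζ * e2

theorem norm_add_I_mul_smul_complexify {ζ : ℂ} {θ : EuclideanSpace ℝ (Fin 2)} (hθ : ‖θ‖ = 1) :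
    ‖(ζ • complexify θ) 0 + Complex.I * (ζ • complexify θ) 1‖ = ‖ζ‖ ∧
    ‖(ζ • complexify θ) 0 - Complex.I * (ζ • complexify θ) 1‖ = ‖ζ‖ := by
  have h1 : θ 0 ^ 2 + θ 1 ^ 2 = 1 := by
    have := EuclideanSpace.real_norm_sq_eq θ
    rw [hθ, Fin.sum_univ_two] at this
    linarith
  have e : ∀ x y : ℝ, x ^ 2 + y ^ 2 = 1 → ‖(x : ℂ) + Complex.I * y‖ = 1 := by
    intro x y h
    rw [mul_comm, Complex.norm_add_mul_I, h, Real.sqrt_one]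
  constructor
  · have : (ζ • complexify θ) 0 + Complex.I * (ζ • complexify θ) 1
        = ζ * ((θ 0 : ℂ) + Complex.I * (θ 1 : ℂ)) := by
      simp [complexify]; ring
    rw [this, norm_mul, e _ _ h1, mul_one]
  · have : (ζ • complexify θ) 0 - Complex.I * (ζ • complexify θ) 1
        = ζ * ((θ 0 : ℂ) + Complex.I * ((-θ 1 : ℝ) : ℂ)) := by
      simp [complexify]; ring
    rw [this, norm_mul, e _ _ (by linarith [neg_sq (θ 1)]), mul_one]

theorem maxModulus_le {f : EuclideanSpace ℂ (Fin 2) → ℂ} {r C : ℝ} (hC : 0 ≤ C)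
    (h : ∀ z, ‖z 0 + Complex.I * z 1‖ = r → ‖z 0 - Complex.I * z 1‖ = r → ‖f z‖ ≤ C) :
    maxModulus f r ≤ C := by
  refine Real.sSup_le ?_ hC
  rintro y ⟨ζ, θ, hζ, hθ, rfl⟩
  have := norm_add_I_mul_smul_complexify (ζ := ζ) hθ
  exact h _ (this.1.trans hζ) (this.2.trans hζ)

theorem norm_le_of_forall_norm_eq_norm_le {g : ℂ → ℂ} (hg : Differentiable ℂ g) {r C : ℝ} (hr : 0 < r)
    (h : ∀ u, ‖u‖ = r → ‖g u‖ ≤ C) {u : ℂ} (hu : ‖u‖ ≤ r) : ‖g u‖ ≤ C := by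
  refine Complex.norm_le_of_forall_mem_frontier_norm_le (U := Metric.ball 0 r)
    Metric.isBounded_ball hg.diffContOnCl ?_ ?_
  · intro z hz
    rw [frontier_ball _ hr.ne'] at hz
    exact h z (by simpa using hz)
  · rw [closure_ball _ hr.ne']
    simpa using hu

theorem bddAbove_maxModulus {f : EuclideanSpace ℂ (Fin 2) → ℂ} (hf : Continuous f) (r : ℝ) :
    BddAbove {y : ℝ | ∃ (ζ : ℂ) (θ : EuclideanSpace ℝ (Fin 2)),
      ‖ζ‖ = r ∧ ‖θ‖ = 1 ∧ y = ‖f (ζ • complexify θ)‖} := by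
  have hc : Continuous fun p : ℂ × EuclideanSpace ℝ (Fin 2) => ‖f (p.1 • complexify p.2)‖ := by
    have : Continuous (complexify : EuclideanSpace ℝ (Fin 2) → _) := by
      unfold complexify
      fun_prop
    fun_prop
  refine (((isCompact_sphere (0 : ℂ) r).prod
    (isCompact_sphere (0 : EuclideanSpace ℝ (Fin 2)) 1)).image hc).bddAbove.mono ?_
  rintro y ⟨ζ, θ, hζ, hθ, rfl⟩
  exact ⟨(ζ, θ), ⟨by simpa using hζ, by simpa using hθ⟩, rfl⟩

/-- The maximum modulus bounds the function on the Lie ball. -/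
theorem norm_le_maxModulus {f : EuclideanSpace ℂ (Fin 2) → ℂ} (hf : IsEntire f) {r : ℝ}
    (hr : 0 < r) {z : EuclideanSpace ℂ (Fin 2)} (h1 : ‖z 0 + Complex.I * z 1‖ ≤ r)
    (h2 : ‖z 0 - Complex.I * z 1‖ ≤ r) : ‖f z‖ ≤ maxModulus f r := by
  have hf' : Differentiable ℂ f := hf
  have key : ∀ u v, ‖u‖ = r → ‖v‖ = r → ‖f (isotropicPoint u v)‖ ≤ maxModulus f r := by
    intro u v hu hv
    obtain ⟨ζ, θ, hζ, hθ, h⟩ := exists_smul_complexify_eq hr hu hv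
    exact le_csSup (bddAbove_maxModulus hf'.continuous r) ⟨ζ, θ, hζ, hθ, by rw [h]⟩
  rw [← isotropicPoint_eq z]
  -- Maximum principle in each isotropic coordinate separately, from the torus to the bidisc.
  refine norm_le_of_forall_norm_eq_norm_le (g := fun u => f (isotropicPoint u _))
    (hf'.comp (differentiable_isotropicPoint_left _)) hr (fun u hu => ?_) h1
  exact norm_le_of_forall_norm_eq_norm_le (g := fun v => f (isotropicPoint u v))
    (hf'.comp (differentiable_isotropicPoint_right _)) hr (fun v hv => key u v hu hv) h2

theorem eventually_le_maxModulus {f : EuclideanSpace ℂ (Fin 2) → ℂ} (hf : IsEntire f)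
    (hnc : ¬ ∃ c, ∀ z, f z = c) (B : ℝ) : ∀ᶠ r in Filter.atTop, B ≤ maxModulus f r := by
  have : ∃ z, B < ‖f z‖ := by
    by_contra! h
    refine hnc ⟨f 0, fun z => ?_⟩
    refine Differentiable.apply_eq_apply_of_bounded (f := f) hf ?_ z 0
    refine isBounded_iff_forall_norm_le.2 ⟨B, ?_⟩
    rintro _ ⟨z, rfl⟩
    exact h z
  obtain ⟨z, hz⟩ := this
  filter_upwards [Filter.eventually_gt_atTop 0,
    Filter.eventually_ge_atTop ‖z 0 + Complex.I * z 1‖,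
    Filter.eventually_ge_atTop ‖z 0 - Complex.I * z 1‖] with r hr h1 h2
  exact hz.le.trans (norm_le_maxModulus hf hr h1 h2)

/-! ### Order and exponential bounds -/

theorem order_const (c : ℂ) : order (fun _ : EuclideanSpace ℂ (Fin 2) => c) = 0 := by
  have hm : ∀ᶠ r : ℝ in Filter.atTop,
      maxModulus (fun _ : EuclideanSpace ℂ (Fin 2) => c) r = ‖c‖ := by
    filter_upwards [Filter.eventually_gt_atTop 0] with r hr
    refine le_antisymm (maxModulus_le (norm_nonneg c) fun _ _ _ => le_rfl) ?_
    exact norm_le_maxModulus (f := fun _ => c) (differentiable_const c) hr (z := 0)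
      (by simpa using hr.le) (by simpa using hr.le)
  have ht : Filter.Tendsto (fun r : ℝ => ((Real.log (Real.log (maxModulus
      (fun _ : EuclideanSpace ℂ (Fin 2) => c) r)) / Real.log r : ℝ) : EReal))
      Filter.atTop (𝓝 ((0 : ℝ) : EReal)) := by
    refine (continuous_coe_real_ereal.tendsto 0).comp ?_
    refine (Real.tendsto_log_atTop.const_div_atTop (Real.log (Real.log ‖c‖))).congr' ?_
    filter_upwards [hm] with r hr
    rw [hr]
  exact ht.limsup_eq

theorem order_eq_zero_of_const {f : EuclideanSpace ℂ (Fin 2) → ℂ} (h : ∃ c, ∀ z, f z = c) :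
    order f = 0 := by
  obtain ⟨c, hc⟩ := h
  rw [show f = fun _ => c from funext hc]
  exact order_const c

theorem order_nonneg {f : EuclideanSpace ℂ (Fin 2) → ℂ} (hf : IsEntire f) : 0 ≤ order f := by
  by_cases hc : ∃ c, ∀ z, f z = c
  · exact (order_eq_zero_of_const hc).ge
  · refine Filter.le_limsup_of_frequently_le (Filter.Eventually.frequently ?_) (by isBoundedDefault)
    filter_upwards [eventually_le_maxModulus hf hc (Real.exp 1), Filter.eventually_ge_atTop 1]
      with r hr hr1
    have h1 : 1 ≤ Real.log (maxModulus f r) := by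
      rwa [Real.le_log_iff_exp_le ((Real.exp_pos 1).trans_le hr)]
    exact_mod_cast div_nonneg (Real.log_nonneg h1) (Real.log_nonneg hr1)

theorem eventually_maxModulus_le_of_order_lt {f : EuclideanSpace ℂ (Fin 2) → ℂ} {s : ℝ}
    (hs : order f < s) : ∀ᶠ r in Filter.atTop, maxModulus f r ≤ Real.exp (r ^ s) := by
  filter_upwards [Filter.eventually_lt_of_limsup_lt hs, Filter.eventually_gt_atTop 1]
    with r hr hr1
  have hr0 : 0 < r := by linarith
  have hr' : Real.log (Real.log (maxModulus f r)) / Real.log r < s := by exact_mod_cast hr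
  rw [div_lt_iff₀ (Real.log_pos hr1)] at hr'
  have hpos : (0 : ℝ) ≤ r ^ s := Real.rpow_nonneg hr0.le s
  -- `Real.log` carries no information at nonpositive arguments, but there the bound is trivial.
  rcases le_or_gt (maxModulus f r) 0 with h0 | h0
  · exact h0.trans (Real.exp_pos _).le
  rw [← Real.log_le_iff_le_exp h0]
  rcases le_or_gt (Real.log (maxModulus f r)) 0 with h1 | h1
  · exact h1.trans hpos
  · rw [Real.rpow_def_of_pos hr0, ← Real.log_le_iff_le_exp h1]
    linarith

theorem order_le_of_eventually_maxModulus_le {f : EuclideanSpace ℂ (Fin 2) → ℂ} (hf : IsEntire f)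
    (hnc : ¬ ∃ c, ∀ z, f z = c) {s : ℝ}
    (hs : ∀ᶠ r in Filter.atTop, maxModulus f r ≤ Real.exp (r ^ s)) : order f ≤ s := by
  refine Filter.limsup_le_of_le (by isBoundedDefault) ?_
  filter_upwards [hs, eventually_le_maxModulus hf hnc (Real.exp 1), Filter.eventually_gt_atTop 1]
    with r hr he hr1
  have h0 : 0 < maxModulus f r := (Real.exp_pos 1).trans_le he
  have h1 : 1 ≤ Real.log (maxModulus f r) := by rwa [Real.le_log_iff_exp_le h0]
  have h2 : Real.log (Real.log (maxModulus f r)) / Real.log r ≤ s := by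
    rw [div_le_iff₀ (Real.log_pos hr1), Real.log_le_iff_le_exp (by linarith), mul_comm,
      ← Real.rpow_def_of_pos (by linarith), Real.log_le_iff_le_exp h0]
    exact hr
  exact_mod_cast h2

/-! ### Growth estimates -/

open Filter in
-- By Bernoulli, a step of `9` raises `(x + R)^τ` by at most `9 (x + R)^(τ - 1)`, which is small for
-- large `R` because `τ < 1`.
theorem eventually_isSlowWeight_exp_rpow {L τ : ℝ} (hL : 0 ≤ L) (hτ0 : 0 < τ) (hτ1 : τ < 1) :
    ∀ᶠ R in atTop, IsSlowWeight fun x => Real.exp (L * (x + R) ^ τ) := by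
  have ht : Tendsto (fun y : ℝ => 9 * L * y ^ (-(1 - τ))) atTop (𝓝 (9 * L * 0)) :=
    (tendsto_rpow_neg_atTop (by linarith)).const_mul _
  rw [mul_zero] at ht
  have h := ht.eventually (ge_mem_nhds (Real.log_pos (one_lt_two)))
  obtain ⟨R₀, hR₀⟩ := eventually_atTop.1 h
  filter_upwards [eventually_ge_atTop R₀, eventually_gt_atTop 0] with R hR hRpos
  refine ⟨fun x _ => (Real.exp_pos _).le, fun x y hx hxy => ?_, fun x hx => ?_⟩
  · gcongr
  · have hy : 0 < x + R := by linarith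
    have h1 := hR₀ (x + R) (by linarith)
    have h2 : (x + 9 + R) ^ τ ≤ (x + R) ^ τ + 9 * (x + R) ^ (-(1 - τ)) := by
      have e : x + 9 + R = (x + R) * (1 + 9 / (x + R)) := by field_simp; ring
      have hb := rpow_one_add_le_one_add_mul_self (s := 9 / (x + R)) (p := τ)
        (by have : 0 < 9 / (x + R) := by positivity
            linarith) hτ0.le hτ1.le
      have hp : (x + R) ^ (-(1 - τ)) = (x + R) ^ τ / (x + R) := by
        rw [show -(1 - τ) = τ - 1 by ring, Real.rpow_sub_one hy.ne']
      rw [e, Real.mul_rpow hy.le (by positivity), hp]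
      calc (x + R) ^ τ * (1 + 9 / (x + R)) ^ τ
          ≤ (x + R) ^ τ * (1 + τ * (9 / (x + R))) := by gcongr
        _ ≤ (x + R) ^ τ * (1 + 1 * (9 / (x + R))) := by gcongr
        _ = _ := by ring
    calc Real.exp (L * (x + 9 + R) ^ τ)
        ≤ Real.exp (Real.log 2 + L * (x + R) ^ τ) := by
          rw [Real.exp_le_exp]
          have := mul_le_mul_of_nonneg_left h2 hL
          linarith
      _ = 2 * Real.exp (L * (x + R) ^ τ) := by
          rw [Real.exp_add, Real.exp_log two_pos]

open Filter in
theorem eventually_mul_exp_rpow_le {s s' K L : ℝ} (hs : 0 < s) (hs' : s < s') (hK : 0 < K) :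
    ∀ᶠ r : ℝ in atTop, K * r * Real.exp (L * r ^ s) ≤ Real.exp (r ^ s') := by
  have h1 := (isLittleO_log_rpow_atTop (hs.trans hs')).def (c := 1 / 3) (by norm_num)
  have h2 : ∀ᶠ r : ℝ in atTop, L * r ^ (-(s' - s)) ≤ 1 / 3 := by
    have ht := (tendsto_rpow_neg_atTop (sub_pos.2 hs')).const_mul L
    rw [mul_zero] at ht
    exact ht.eventually (ge_mem_nhds (by norm_num))
  have h3 := (tendsto_rpow_atTop (hs.trans hs')).eventually_ge_atTop (3 * Real.log K)
  filter_upwards [h1, h2, h3, eventually_gt_atTop 0] with r h1 h2 h3 hr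
  have hp : 0 ≤ r ^ s' := Real.rpow_nonneg hr.le _
  rw [Real.norm_of_nonneg hp] at h1
  have h1' := (Real.le_norm_self _).trans h1
  have h2' := mul_le_mul_of_nonneg_right h2 hp
  rw [mul_assoc, ← Real.rpow_add hr, show -(s' - s) + s' = s by ring] at h2'
  rw [← Real.exp_log (mul_pos hK hr), ← Real.exp_add, Real.exp_le_exp, Real.log_mul hK.ne' hr.ne']
  linarith

/-- The restriction of `f` to the complexified parabola `a z₁ = z₂²`. -/
noncomputable def parabolaRestriction (f : EuclideanSpace ℂ (Fin 2) → ℂ) (a : ℝ) (t : ℂ) : ℂ :=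
  f (WithLp.toLp 2 ![(a : ℂ) * t ^ 2, (a : ℂ) * t])

theorem differentiable_parabolaRestriction {f : EuclideanSpace ℂ (Fin 2) → ℂ} (hf : IsEntire f)
    (a : ℝ) : Differentiable ℂ (parabolaRestriction f a) := by
  refine Differentiable.comp (g := f) hf ?_
  rw [differentiable_euclidean]
  intro i
  fin_cases i
  · simp
  · simp; fun_prop

open Filter in
theorem exists_norm_parabolaRestriction_le {f : EuclideanSpace ℂ (Fin 2) → ℂ} (hf : IsEntire f)
    {a : ℝ} (ha : a ≠ 0) {s : ℝ} (hs0 : 0 < s) (hs1 : s < 1 / 2) (hs : order f < s) :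
    ∃ L R : ℝ, 0 ≤ L ∧ 1 ≤ R ∧ IsSlowWeight (fun x => Real.exp (L * (x + R) ^ (2 * s))) ∧
      ∀ t, ‖parabolaRestriction f a t‖ ≤ Real.exp (L * (‖t‖ + R) ^ (2 * s)) := by
  obtain ⟨r₀, hr₀⟩ := eventually_atTop.1 (eventually_maxModulus_le_of_order_lt hs)
  have ha' : 0 < |a| := abs_pos.2 ha
  have hL : 0 ≤ |a| ^ s := by positivity
  -- `R` gives doubling, makes `‖t‖² + ‖t‖ ≤ (‖t‖ + R)²`, and pushes the radius `|a| (‖t‖ + R)²`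
  -- past `r₀`.
  obtain ⟨R, hRW, hR1, hR2⟩ := ((eventually_isSlowWeight_exp_rpow hL (τ := 2 * s) (by linarith)
    (by linarith)).and ((eventually_ge_atTop 1).and (eventually_ge_atTop (r₀ / |a|)))).exists
  refine ⟨|a| ^ s, R, hL, hR1, hRW, fun t => ?_⟩
  have ht := norm_nonneg t
  have hr0 : 0 < |a| * (‖t‖ + R) ^ 2 := by positivity
  have hrr : r₀ ≤ |a| * (‖t‖ + R) ^ 2 := by
    rw [div_le_iff₀ ha'] at hR2
    have : R ≤ (‖t‖ + R) ^ 2 := by nlinarith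
    nlinarith
  have hle : |a| * (‖t‖ ^ 2 + ‖t‖) ≤ |a| * (‖t‖ + R) ^ 2 := by
    apply mul_le_mul_of_nonneg_left _ ha'.le
    nlinarith
  have hcoord : ∀ ε : ℂ, ‖ε‖ = 1 →
      ‖(a : ℂ) * t ^ 2 + ε * ((a : ℂ) * t)‖ ≤ |a| * (‖t‖ + R) ^ 2 := by
    intro ε hε
    refine (norm_add_le _ _).trans (le_trans (le_of_eq ?_) hle)
    rw [norm_mul, norm_mul, norm_mul, norm_pow, hε, Complex.norm_real, Real.norm_eq_abs]
    ring
  have h := norm_le_maxModulus hf hr0 (z := WithLp.toLp 2 ![(a : ℂ) * t ^ 2, (a : ℂ) * t])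
    (by simpa using hcoord Complex.I Complex.norm_I)
    (by simpa [sub_eq_add_neg] using hcoord (-Complex.I) (by simp))
  refine h.trans ((hr₀ _ hrr).trans (le_of_eq ?_))
  rw [Real.mul_rpow ha'.le (by positivity), Real.rpow_mul (by positivity), Real.rpow_two]

/-- Growth of an even function transfers to the same function in the variable `t ^ 2`. -/
theorem norm_le_of_comp_sq {φ α : ℂ → ℂ} (hα : ∀ t, α (t ^ 2) = φ t) {L R s : ℝ} (hL : 0 ≤ L)
    (hR : 1 ≤ R) (hs : 0 < s)
    (hφ : ∀ t, ‖φ t‖ ≤ (1 + 2 * ‖t‖) * Real.exp (L * (‖t‖ + R) ^ (2 * s)))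
    {q r : ℝ} (hq : 0 ≤ q) (hr : 1 ≤ r) {w : ℂ} (hw : ‖w‖ ≤ q * r) :
    ‖α w‖ ≤ 2 * (√q + R) * r * Real.exp (L * (√q + R) ^ (2 * s) * r ^ s) := by
  obtain ⟨t, rfl⟩ := IsAlgClosed.exists_pow_nat_eq w two_pos
  rw [hα]
  have hr0 : 0 ≤ r := by linarith
  have hsr : 1 ≤ √r := Real.one_le_sqrt.2 hr
  have ht0 := norm_nonneg t
  have ht : ‖t‖ ≤ √q * √r := by
    rw [← Real.sqrt_mul hq]
    rw [norm_pow] at hw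
    exact Real.le_sqrt_of_sq_le hw
  have h1 : ‖t‖ + R ≤ (√q + R) * √r := by nlinarith
  have h2 : 1 + 2 * ‖t‖ ≤ 2 * (√q + R) * r := by
    have h3 : √r ≤ r := by
      calc √r ≤ √r * √r := by nlinarith
        _ = r := Real.mul_self_sqrt hr0
    have h4 : (√q + R) * √r ≤ (√q + R) * r :=
      mul_le_mul_of_nonneg_left h3 (by positivity)
    linarith
  have h5 : (‖t‖ + R) ^ (2 * s) ≤ (√q + R) ^ (2 * s) * r ^ s := by
    calc (‖t‖ + R) ^ (2 * s) ≤ ((√q + R) * √r) ^ (2 * s) := by gcongr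
      _ = (√q + R) ^ (2 * s) * r ^ s := by
        rw [Real.mul_rpow (by positivity) (by positivity), Real.rpow_mul (Real.sqrt_nonneg r),
          Real.rpow_two, Real.sq_sqrt hr0]
  refine (hφ t).trans (mul_le_mul h2 ?_ (Real.exp_pos _).le (by positivity))
  rw [Real.exp_le_exp, mul_assoc]
  exact mul_le_mul_of_nonneg_left h5 hL

/-! ### Construction of the harmonic function -/

theorem mainTheorem2 (f : EuclideanSpace ℂ (Fin 2) → ℂ) (hf : IsEntire f)
    (hord : order f < ((1 / 2 : ℝ) : EReal)) (a : ℝ) (ha : a ≠ 0) :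
    ∃ h : EuclideanSpace ℂ (Fin 2) → ℂ, IsEntireHarmonic h ∧ order h ≤ order f ∧
      ∀ x ∈ parabola a, h (complexify x) = f (complexify x) := by
  have hpos : ∀ s : ℝ, order f < s → 0 < s := fun s hs => by
    exact_mod_cast (order_nonneg hf).trans_lt hs
  have hac : (a : ℂ) ≠ 0 := by exact_mod_cast ha
  have hW : ∃ W, IsSlowWeight W ∧ ∀ t, ‖parabolaRestriction f a t‖ ≤ W ‖t‖ := by
    obtain ⟨s, hs1, hs2⟩ := EReal.lt_iff_exists_real_btwn.1 hord
    obtain ⟨L, R, _, _, h, h'⟩ := exists_norm_parabolaRestriction_le hf ha (hpos s hs1)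
      (by exact_mod_cast hs2) hs1
    exact ⟨_, h, h'⟩
  obtain ⟨φ, ψ, hφd, hψd, hφe, hψe, hsum, hbound⟩ :=
    exists_even_shift_add_even_shift (differentiable_parabolaRestriction hf a) hW
  obtain ⟨α, hαd, hα⟩ := exists_differentiable_comp_sq hφd hφe
  obtain ⟨β, hβd, hβ⟩ := exists_differentiable_comp_sq hψd hψe
  set h : EuclideanSpace ℂ (Fin 2) → ℂ := fun z =>
    α ((z 0 + Complex.I * z 1) / a - 1 / 4) + β ((z 0 - Complex.I * z 1) / a - 1 / 4) with hh
  have hentire : IsEntire h := by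
    have h0 : Differentiable ℂ fun z : EuclideanSpace ℂ (Fin 2) => z 0 :=
      (EuclideanSpace.proj (𝕜 := ℂ) (0 : Fin 2)).differentiable
    have h1 : Differentiable ℂ fun z : EuclideanSpace ℂ (Fin 2) => z 1 :=
      (EuclideanSpace.proj (𝕜 := ℂ) (1 : Fin 2)).differentiable
    exact (hαd.comp (by fun_prop)).add (hβd.comp (by fun_prop))
  refine ⟨h, ⟨hentire, fun x _ => ?_⟩, ?_, ?_⟩
  · have hA := harmonicAt_comp_isotropic (A := fun w => α (w / a - 1 / 4))
      (hαd.comp (by fun_prop)) Complex.I_sq x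
    have hB := harmonicAt_comp_isotropic (A := fun w => β (w / a - 1 / 4))
      (hβd.comp (by fun_prop)) (c := -Complex.I) (by rw [neg_sq, Complex.I_sq]) x
    refine (InnerProductSpace.harmonicAt_congr_nhds (Filter.Eventually.of_forall fun y => ?_)).1
      (hA.add hB)
    simp [hh, complexify, sub_eq_add_neg]
  · by_cases hc : ∃ c, ∀ z, h z = c
    · rw [order_eq_zero_of_const hc]
      exact order_nonneg hf
    refine le_of_forall_gt_imp_ge_of_dense fun c hfc => ?_
    obtain ⟨s', hs'1, hs'2⟩ := EReal.lt_iff_exists_real_btwn.1 hfc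
    refine le_trans ?_ hs'2.le
    -- `s < 1/2` makes the weight slow; `s < s'` leaves room to absorb the polynomial factor and the
    -- constants. `φ` and `ψ` were fixed before `s`.
    obtain ⟨s, hs1, hs2⟩ := EReal.lt_iff_exists_real_btwn.1 (lt_min hs'1 hord)
    have hss' : s < s' := by exact_mod_cast hs2.trans_le (min_le_left _ _)
    have hs0 := hpos s hs1
    obtain ⟨L, R, hL, hR, hLR, hFb⟩ := exists_norm_parabolaRestriction_le hf ha hs0
      (by exact_mod_cast hs2.trans_le (min_le_right _ _)) hs1
    have hb := hbound _ hLR hFb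
    set q : ℝ := 1 / |a| + 1 / 4 with hq
    have hq0 : 0 ≤ q := by positivity
    refine order_le_of_eventually_maxModulus_le hentire hc ?_
    -- `K` is twice the factor `2 (√q + R)` in `norm_le_of_comp_sq`, once for each of `α` and `β`.
    filter_upwards [eventually_mul_exp_rpow_le (K := 4 * (√q + R))
      (L := L * (√q + R) ^ (2 * s)) hs0 hss' (by positivity), Filter.eventually_ge_atTop 1]
      with r hr hr1
    refine maxModulus_le (Real.exp_pos _).le fun z hz1 hz2 => le_trans ?_ hr
    have hw : ∀ u : ℂ, ‖u‖ = r → ‖u / a - 1 / 4‖ ≤ q * r := by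
      intro u hu
      refine (norm_sub_le _ _).trans ?_
      rw [norm_div, hu, Complex.norm_real, Real.norm_eq_abs]
      have : ‖(1 / 4 : ℂ)‖ = 1 / 4 := by simp
      rw [this, hq, add_mul, one_div_mul_eq_div]
      linarith
    have h1 := norm_le_of_comp_sq hα hL hR hs0 (fun t => (hb t).1) hq0 hr1 (hw _ hz1)
    have h2 := norm_le_of_comp_sq hβ hL hR hs0 (fun t => (hb t).2) hq0 hr1 (hw _ hz2)
    refine (norm_add_le _ _).trans ?_
    linarith
  · intro x hx
    have hx' : (a : ℂ) * (x 0 : ℂ) = (x 1 : ℂ) ^ 2 := by exact_mod_cast hx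
    have hx0 : (x 0 : ℂ) = (x 1 : ℂ) ^ 2 / a := by rw [eq_div_iff hac]; linear_combination hx'
    have hF : parabolaRestriction f a ((x 1 : ℂ) / a) = f (complexify x) := by
      unfold parabolaRestriction complexify
      congr 2
      ext i
      fin_cases i
      · simp [hx0]
        field_simp
      · simp
        field_simp
    rw [← hF, ← hsum, ← hα, ← hβ]
    simp only [hh, complexify]
    congr 2
    · rw [hx0]
      field_simp
      linear_combination -4 * (a : ℂ) ^ 2 * Complex.I_sq
    · rw [hx0]
      field_simp
      linear_combination -4 * (a : ℂ) ^ 2 * Complex.I_sq
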